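/- Theorem 2 (Global Hartman–Grobman). Let $E\subseteq\mathbb{R}^n$ be an open set containing the origin, let $f:E\to\mathbb{R}^n$ be of class $C^1$ with $f(0)=0$, and put $A=Df(0)$. (a) Suppose that every (complex) eigenvalue of $A$ has negative real part. Let $\Omega\subseteq E$ be the region of attraction of $0$, that is, the set of all $x_0\in E$ for which the solution of $\dot x=f(x)$, $x(0)=x_0$, exists in $E$ for all $t\ge 0$ and tends to $0$ as $t\to+\infty$. Suppose that the flow $\phi_t(x_0)$ of $\dot x=f(x)$ on $E$ is defined for all $t\in\mathbb{R}$ and all $x_0\in\Omega$, that is, solutions starting in $\Omega$ exist in $E$ for all real times. Then there is a homeomorphism $H$ from $\Omega$ onto $\mathbb{R}^n$ with $H(0)=0$ that transforms $\dot x=f(x)$ on $\Omega$ into the linear system $\dot y=Ay$ on $\mathbb{R}^n$: for every interval $J\subseteq\mathbb{R}$, a curve $x:J\to\Omega$ is a solution of $\dot x=f(x)$ if and only if $y(t)=H(x(t))$ is a solution of $\dot y=Ay$ on $J$. (b) Suppose instead that every eigenvalue of $A$ has positive real part. Let $\Omega^-\subseteq E$ be the region of repulsion of $0$, that is, the set of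 all $x_0\in E$ for which the solution with $x(0)=x_0$ exists in $E$ for all $t\le 0$ and tends to $0$ as $t\to-\infty$, and suppose that solutions starting in $\Omega^-$ exist in $E$ for all real times. Then there is a homeomorphism $H$ from $\Omega^-$ onto $\mathbb{R}^n$ with $H(0)=0$ that transforms $\dot x=f(x)$ on $\Omega^-$ into $\dot y=Ay$ on $\mathbb{R}^n$ in the same sense. -/

import Mathlib

open Set Filter Topology

/-- `x` has a solution of `ẋ = f x` through it, at time `0`, which exists for all real times and
stays in `E`: the whole orbit `t ↦ φ_t x`, `t ∈ ℝ`, of the system on `E` is defined. -/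
def HasGlobalSolution {n : ℕ}
    (f : EuclideanSpace ℝ (Fin n) → EuclideanSpace ℝ (Fin n))
    (E : Set (EuclideanSpace ℝ (Fin n))) (x : EuclideanSpace ℝ (Fin n)) : Prop :=
  ∃ γ : ℝ → EuclideanSpace ℝ (Fin n),
    γ 0 = x ∧ IsIntegralCurve γ (fun _ => f) ∧ ∀ t, γ t ∈ E

/-- The region of attraction of the origin for the system `ẋ = f x` on `E`: the initial values
whose solution exists in `E` for all `t ≥ 0` and tends to `0` as `t → +∞`. -/
def regionOfAttraction {n : ℕ}
    (f : EuclideanSpace ℝ (Fin n) → EuclideanSpace ℝ (Fin n))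
    (E : Set (EuclideanSpace ℝ (Fin n))) : Set (EuclideanSpace ℝ (Fin n)) :=
  {x | ∃ γ : ℝ → EuclideanSpace ℝ (Fin n),
    γ 0 = x ∧ IsIntegralCurveOn γ (fun _ => f) (Ici 0) ∧ (∀ t ∈ Ici (0 : ℝ), γ t ∈ E) ∧
      Tendsto γ atTop (𝓝 0)}

/-- The region of repulsion of the origin for the system `ẋ = f x` on `E`: the initial values
whose solution exists in `E` for all `t ≤ 0` and tends to `0` as `t → -∞`. -/
def regionOfRepulsion {n : ℕ}
    (f : EuclideanSpace ℝ (Fin n) → EuclideanSpace ℝ (Fin n))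
    (E : Set (EuclideanSpace ℝ (Fin n))) : Set (EuclideanSpace ℝ (Fin n)) :=
  {x | ∃ γ : ℝ → EuclideanSpace ℝ (Fin n),
    γ 0 = x ∧ IsIntegralCurveOn γ (fun _ => f) (Iic 0) ∧ (∀ t ∈ Iic (0 : ℝ), γ t ∈ E) ∧
      Tendsto γ atBot (𝓝 0)}

/-- Under `y = H x`, the system `ẋ = f x` on `Ω` becomes the linear system `ẏ = A y` on the
whole space: on every interval `J`, a curve `x(t)` in `Ω` solves `ẋ = f x` if and only if
`y(t) = H (x(t))` solves `ẏ = A y`. -/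
def TransformsToLinear {n : ℕ}
    (f : EuclideanSpace ℝ (Fin n) → EuclideanSpace ℝ (Fin n))
    (A : EuclideanSpace ℝ (Fin n) →L[ℝ] EuclideanSpace ℝ (Fin n))
    {Ω : Set (EuclideanSpace ℝ (Fin n))} (H : Ω ≃ₜ EuclideanSpace ℝ (Fin n)) : Prop :=
  ∀ (J : Set ℝ), J.OrdConnected → ∀ x : ℝ → Ω,
    IsIntegralCurveOn (fun t => (x t : EuclideanSpace ℝ (Fin n))) (fun _ => f) J ↔
      IsIntegralCurveOn (fun t => H (x t)) (fun _ y => A y) J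

/-- `μ` is a (complex) eigenvalue of the real linear operator `A`. -/
def IsComplexEigenvalue {n : ℕ}
    (A : EuclideanSpace ℝ (Fin n) →L[ℝ] EuclideanSpace ℝ (Fin n)) (μ : ℂ) : Prop :=
  Module.End.HasEigenvalue
    ((A : EuclideanSpace ℝ (Fin n) →ₗ[ℝ] EuclideanSpace ℝ (Fin n)).baseChange ℂ) μ

/-! As A is stable, some quadratic form V(x) = ⟪P x, x⟫ decreases strictly along ẏ = Ay
(`exists_lyapunov_operator`) and, near 0, along ẋ = f(x) as well (`exists_isQuadraticLyapunov`).
Hence both flows cross a small ellipsoid {V = a} inwards, and every nonzero orbit of either flow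
crosses it exactly once: forwards it tends to 0, and backwards it cannot stay inside, because V
decays exponentially there. Away from 0 each phase space is therefore ellipsoid × time. Sending φ_t
s to e^{tA} s for s on the ellipsoid, and 0 to 0, defines H. It is continuous at 0 because points
near 0 crossed the ellipsoid long ago and the decay is uniform on the ellipsoid
(`IsTrappingLevel.exists_homeomorph`). H need not be differentiable, but being a solution on an
interval amounts to the relation x(t) = φ_{t-s}(x(s)) (`Flow.isIntegralCurveOn_iff`), which H
transports. Part (b) is part (a) for -f, with time reversed. -/

section ODE

/-! ### Solutions of C¹ systems: uniqueness, global existence, dependence on initial values, flows.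
-/

variable {F : Type*} [NormedAddCommGroup F] [NormedSpace ℝ F]

/-- A `C¹` map on an open set is Lipschitz on every compact subset. -/
theorem ContDiffOn.exists_lipschitzOnWith_of_isCompact {f : F → F} {E K : Set F}
    (hf : ContDiffOn ℝ 1 f E) (hE : IsOpen E) (hK : IsCompact K) (hKE : K ⊆ E) :
    ∃ L, LipschitzOnWith L f K := by
  refine LocallyLipschitzOn.exists_lipschitzOnWith_of_compact hK fun x hx => ?_
  obtain ⟨L, t, ht, h⟩ := (hf.contDiffAt (hE.mem_nhds (hKE hx))).exists_lipschitzOnWith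
  exact ⟨L, t, mem_nhdsWithin_of_mem_nhds ht, h⟩

/-- Uniqueness of solutions of an autonomous `C¹` system on an interval. -/
theorem IsIntegralCurveOn.eqOn_of_contDiffOn {f : F → F} {E : Set F} (hE : IsOpen E)
    (hf : ContDiffOn ℝ 1 f E) {J : Set ℝ} (hJ : J.OrdConnected) {γ₁ γ₂ : ℝ → F}
    (h₁ : IsIntegralCurveOn γ₁ (fun _ => f) J) (h₂ : IsIntegralCurveOn γ₂ (fun _ => f) J)
    (hE₁ : ∀ t ∈ J, γ₁ t ∈ E) (hE₂ : ∀ t ∈ J, γ₂ t ∈ E) {t₀ : ℝ} (ht₀ : t₀ ∈ J)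
    (h : γ₁ t₀ = γ₂ t₀) : EqOn γ₁ γ₂ J := by
  -- Grönwall needs one Lipschitz constant valid along both curves; compactness of the two arcs
  -- provides it.
  have key : ∀ a b, Icc a b ⊆ J → ∃ L, LipschitzOnWith L f (γ₁ '' Icc a b ∪ γ₂ '' Icc a b) := by
    intro a b hab
    refine hf.exists_lipschitzOnWith_of_isCompact hE
      ((isCompact_Icc.image_of_continuousOn (h₁.continuousOn.mono hab)).union
      (isCompact_Icc.image_of_continuousOn (h₂.continuousOn.mono hab))) ?_
    rintro _ (⟨t, ht, rfl⟩ | ⟨t, ht, rfl⟩)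
    exacts [hE₁ t (hab ht), hE₂ t (hab ht)]
  intro t ht
  rcases le_total t₀ t with htt | htt
  · have hab : Icc t₀ t ⊆ J := hJ.out ht₀ ht
    obtain ⟨L, hL⟩ := key _ _ hab
    have hd : ∀ γ : ℝ → F, IsIntegralCurveOn γ (fun _ => f) J → ∀ s ∈ Ico t₀ t,
        HasDerivWithinAt γ (f (γ s)) (Ici s) s := fun γ hγ s hs =>
      (hγ s (hab (Ico_subset_Icc_self hs))).mono_of_mem_nhdsWithin
        (mem_of_superset (Icc_mem_nhdsGE_of_mem hs) hab)
    exact ODE_solution_unique_of_mem_Icc_right (v := fun _ => f) (fun s _ => hL)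
      (h₁.continuousOn.mono hab) (hd _ h₁)
      (fun s hs => Or.inl (mem_image_of_mem _ (Ico_subset_Icc_self hs)))
      (h₂.continuousOn.mono hab) (hd _ h₂)
      (fun s hs => Or.inr (mem_image_of_mem _ (Ico_subset_Icc_self hs))) h ⟨htt, le_rfl⟩
  · have hab : Icc t t₀ ⊆ J := hJ.out ht ht₀
    obtain ⟨L, hL⟩ := key _ _ hab
    have hd : ∀ γ : ℝ → F, IsIntegralCurveOn γ (fun _ => f) J → ∀ s ∈ Ioc t t₀,
        HasDerivWithinAt γ (f (γ s)) (Iic s) s := fun γ hγ s hs =>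
      (hγ s (hab (Ioc_subset_Icc_self hs))).mono_of_mem_nhdsWithin
        (mem_of_superset (Icc_mem_nhdsLE_of_mem hs) hab)
    exact ODE_solution_unique_of_mem_Icc_left (v := fun _ => f) (fun s _ => hL)
      (h₁.continuousOn.mono hab) (hd _ h₁)
      (fun s hs => Or.inl (mem_image_of_mem _ (Ioc_subset_Icc_self hs)))
      (h₂.continuousOn.mono hab) (hd _ h₂)
      (fun s hs => Or.inr (mem_image_of_mem _ (Ioc_subset_Icc_self hs))) h ⟨le_rfl, htt⟩

theorem IsIntegralCurve.eq_of_contDiffOn {f : F → F} {E : Set F} (hE : IsOpen E)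
    (hf : ContDiffOn ℝ 1 f E) {γ₁ γ₂ : ℝ → F}
    (h₁ : IsIntegralCurve γ₁ (fun _ => f)) (h₂ : IsIntegralCurve γ₂ (fun _ => f))
    (hE₁ : ∀ t, γ₁ t ∈ E) (hE₂ : ∀ t, γ₂ t ∈ E) {t₀ : ℝ}
    (h : γ₁ t₀ = γ₂ t₀) : γ₁ = γ₂ :=
  funext fun t => IsIntegralCurveOn.eqOn_of_contDiffOn hE hf ordConnected_univ
    (h₁.isIntegralCurveOn _) (h₂.isIntegralCurveOn _) (fun t _ => hE₁ t) (fun t _ => hE₂ t)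
    (mem_univ t₀) h (mem_univ t)

/-- Time reversal of an integral curve. -/
theorem IsIntegralCurveOn.comp_neg {f : F → F} {γ : ℝ → F} {J : Set ℝ}
    (h : IsIntegralCurveOn γ (fun _ => f) J) :
    IsIntegralCurveOn (fun t => γ (-t)) (fun _ x => -f x) (Neg.neg ⁻¹' J) := by
  intro t ht
  have := HasDerivWithinAt.scomp t (h (-t) ht) (hasDerivAt_neg t).hasDerivWithinAt
    (fun s hs => hs : MapsTo Neg.neg (Neg.neg ⁻¹' J) J)
  simpa [Function.comp_def] using this

theorem IsIntegralCurve.comp_neg {f : F → F} {γ : ℝ → F} (h : IsIntegralCurve γ (fun _ => f)) :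
    IsIntegralCurve (fun t => γ (-t)) (fun _ x => -f x) := by
  rw [← isIntegralCurveOn_univ] at h ⊢
  simpa using h.comp_neg

/-- A bounded Lipschitz vector field is complete. -/
theorem LipschitzWith.exists_isIntegralCurve [CompleteSpace F] {g : F → F} {L M : NNReal}
    (hg : LipschitzWith L g) (hM : ∀ x, ‖g x‖ ≤ M) (x : F) :
    ∃ γ : ℝ → F, γ 0 = x ∧ IsIntegralCurve γ (fun _ => g) := by
  have hloc : ∀ N : ℕ, ∃ γ : ℝ → F, γ 0 = x ∧ ∀ t ∈ Ioo (-(N + 1 : ℝ)) (N + 1),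
      HasDerivAt γ (g (γ t)) t := by
    intro N
    have h0 : (0 : ℝ) ∈ Icc (-(N + 1 : ℝ)) (N + 1) := by
      have := N.cast_nonneg (α := ℝ)
      constructor <;> linarith
    -- A curve of speed at most M moves at most M(N + 1) in time N + 1, so a ball of that radius
    -- never restricts the time interval.
    have : IsPicardLindelof (fun _ => g) (⟨0, h0⟩ : Icc (-(N + 1 : ℝ)) (N + 1)) x
        (M * (N + 1)) 0 M L :=
      { lipschitzOnWith := fun t _ => hg.lipschitzOnWith
        continuousOn := fun x _ => continuousOn_const
        norm_le := fun t _ y _ => hM y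
        mul_max_le := by simp }
    obtain ⟨γ, h1, h2⟩ := this.exists_eq_forall_mem_Icc_hasDerivWithinAt₀
    exact ⟨γ, h1, fun t ht => (h2 t (Ioo_subset_Icc_self ht)).hasDerivAt (Icc_mem_nhds ht.1 ht.2)⟩
  choose Γ hΓ0 hΓ using hloc
  have hagree : ∀ N M : ℕ, ∀ t : ℝ, |t| < N + 1 → |t| < M + 1 → Γ N t = Γ M t := by
    have : ∀ N M : ℕ, N ≤ M → ∀ t : ℝ, |t| < N + 1 → Γ N t = Γ M t := by
      intro N M hNM t ht
      have hNM' : (N : ℝ) ≤ M := by exact_mod_cast hNM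
      have h0 : (0 : ℝ) ∈ Ioo (-(N + 1 : ℝ)) (N + 1) := by
        have := N.cast_nonneg (α := ℝ)
        constructor <;> linarith
      exact ODE_solution_unique_of_mem_Ioo (v := fun _ => g) (s := fun _ => univ) (K := L)
        (fun s _ => hg.lipschitzOnWith) h0 (fun s hs => ⟨hΓ N s hs, trivial⟩)
        (fun s hs => ⟨hΓ M s ⟨by linarith [hs.1], by linarith [hs.2]⟩, trivial⟩)
        (by rw [hΓ0, hΓ0]) (abs_lt.1 ht)
    intro N M t hN hM
    rcases le_total N M with h | h
    exacts [this N M h t hN, (this M N h t hM).symm]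
  -- The index jumps with t, but near t the glued curve agrees with the single solution `Γ ⌈|t|⌉₊`.
  refine ⟨fun t => Γ ⌈|t|⌉₊ t, by simp [hΓ0], fun t => ?_⟩
  have hlt : ∀ s : ℝ, |s| < (⌈|s|⌉₊ : ℝ) + 1 := fun s => by linarith [Nat.le_ceil |s|]
  have hev : (fun s => Γ ⌈|s|⌉₊ s) =ᶠ[𝓝 t] Γ ⌈|t|⌉₊ := by
    filter_upwards [continuous_abs.continuousAt.eventually_lt continuousAt_const (hlt t)] with s hs
    exact hagree _ _ s (hlt s) hs
  exact (hΓ _ t (abs_lt.1 (hlt t))).congr_of_eventuallyEq hev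

/-- Two-sided Grönwall estimate for global solutions. -/
theorem LipschitzWith.dist_integralCurve_le {g : F → F} {L : NNReal}
    (hg : LipschitzWith L g) {γ₁ γ₂ : ℝ → F} (h₁ : IsIntegralCurve γ₁ (fun _ => g))
    (h₂ : IsIntegralCurve γ₂ (fun _ => g)) (t : ℝ) :
    dist (γ₁ t) (γ₂ t) ≤ dist (γ₁ 0) (γ₂ 0) * Real.exp (L * |t|) := by
  have key : ∀ {g : F → F}, LipschitzWith L g → ∀ {γ₁ γ₂ : ℝ → F},
      IsIntegralCurve γ₁ (fun _ => g) → IsIntegralCurve γ₂ (fun _ => g) → ∀ t, 0 ≤ t →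
      dist (γ₁ t) (γ₂ t) ≤ dist (γ₁ 0) (γ₂ 0) * Real.exp (L * t) := by
    intro g hg γ₁ γ₂ h₁ h₂ t ht
    have := dist_le_of_trajectories_ODE (v := fun _ => g) (a := 0) (b := t) (fun _ => hg)
      h₁.continuous.continuousOn (fun s _ => (h₁ s).hasDerivWithinAt)
      h₂.continuous.continuousOn (fun s _ => (h₂ s).hasDerivWithinAt) le_rfl t ⟨ht, le_rfl⟩
    simpa using this
  rcases le_total 0 t with ht | ht
  · rw [abs_of_nonneg ht]
    exact key hg h₁ h₂ t ht
  · rw [abs_of_nonpos ht]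
    simpa using key hg.neg h₁.comp_neg h₂.comp_neg (-t) (by linarith)

/-- A `C¹` vector field on an open set can be modified away from a compact set so as to become
globally Lipschitz and bounded. -/
theorem ContDiffOn.exists_lipschitzWith_bounded_eqOn [FiniteDimensional ℝ F] {f : F → F}
    {E K : Set F} (hf : ContDiffOn ℝ 1 f E) (hE : IsOpen E) (hK : IsCompact K) (hKE : K ⊆ E) :
    ∃ (g : F → F) (L M : NNReal), LipschitzWith L g ∧ (∀ x, ‖g x‖ ≤ M) ∧ EqOn g f K := by
  have := FiniteDimensional.proper_real F
  obtain ⟨K', hK', hKK', hK'E⟩ := exists_compact_between hK hE hKE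
  obtain ⟨χ, hχ0, hχ1, -⟩ := exists_contMDiffMap_zero_one_nhds_of_isClosed (n := 1)
    (modelWithCornersSelf ℝ F) isOpen_interior.isClosed_compl hK.isClosed
    (disjoint_compl_left_iff_subset.2 hKK')
  have hχ : ContDiff ℝ 1 χ := χ.contMDiff.contDiff
  have hzero : ∀ x ∉ K', χ x = 0 := fun x hx =>
    hχ0.self_of_nhdsSet x fun h => hx (interior_subset h)
  -- Nothing is known about f outside E; the product is C¹ there because χ vanishes near every point
  -- off the interior of K'.
  have hg : ContDiff ℝ 1 (fun x => χ x • f x) := by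
    rw [contDiff_iff_contDiffAt]
    intro x
    by_cases hx : x ∈ interior K'
    · exact hχ.contDiffAt.smul
        (hf.contDiffAt (hE.mem_nhds (hK'E (interior_subset hx))))
    · have : (fun x => χ x • f x) =ᶠ[𝓝 x] fun _ => 0 := by
        filter_upwards [eventually_nhdsSet_iff_forall.1 hχ0 x hx] with y hy
        simp [hy]
      exact contDiffAt_const.congr_of_eventuallyEq this
  have hs : HasCompactSupport (fun x => χ x • f x) :=
    HasCompactSupport.intro hK' fun x hx => by simp [hzero x hx]
  obtain ⟨L, hL⟩ := hg.lipschitzWith_of_hasCompactSupport hs one_ne_zero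
  obtain ⟨M, hM⟩ := hs.exists_bound_of_continuous hg.continuous
  refine ⟨_, L, M.toNNReal, hL, fun x => (hM x).trans (Real.le_coe_toNNReal M), fun x hx => ?_⟩
  simp [hχ1.self_of_nhdsSet x hx]

/-- Locally Lipschitz dependence of solutions on the initial value, on bounded time intervals. -/
theorem exists_dist_integralCurve_le [FiniteDimensional ℝ F] {f : F → F} {E : Set F}
    (hE : IsOpen E) (hf : ContDiffOn ℝ 1 f E) {γ₀ : ℝ → F} (h₀ : IsIntegralCurve γ₀ (fun _ => f))
    (hE₀ : ∀ t, γ₀ t ∈ E) (T : ℝ) :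
    ∃ δ > 0, ∃ C : ℝ, ∀ γ : ℝ → F, IsIntegralCurve γ (fun _ => f) → (∀ t, γ t ∈ E) →
      dist (γ 0) (γ₀ 0) < δ → ∀ t ∈ Icc (-T) T, dist (γ t) (γ₀ t) ≤ C * dist (γ 0) (γ₀ 0) := by
  have := FiniteDimensional.proper_real F
  have hK : IsCompact (γ₀ '' Icc (-T) T) := isCompact_Icc.image h₀.continuous
  obtain ⟨δ, hδ, hδE⟩ := hK.exists_cthickening_subset_open hE (by rintro _ ⟨t, -, rfl⟩; exact hE₀ t)
  obtain ⟨g, L, M, hL, hM, hgf⟩ := hf.exists_lipschitzWith_bounded_eqOn hE hK.cthickening hδE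
  have hmem : ∀ t ∈ Icc (-T) T, γ₀ t ∈ Metric.cthickening δ (γ₀ '' Icc (-T) T) := fun t ht =>
    Metric.self_subset_cthickening _ (mem_image_of_mem _ ht)
  -- With this initial distance, Grönwall keeps the solution Γ of the modified field in the δ-tube
  -- around γ₀. There g = f, so uniqueness identifies Γ with γ, which was not known beforehand to
  -- stay in the tube.
  refine ⟨δ / Real.exp (L * T), by positivity, Real.exp (L * T), fun γ hγ hγE hd t ht => ?_⟩
  rw [lt_div_iff₀ (Real.exp_pos _)] at hd
  have hT : 0 ≤ T := by linarith [ht.1, ht.2]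
  have h0 : (0 : ℝ) ∈ Icc (-T) T := ⟨by linarith, hT⟩
  obtain ⟨Γ₀, hΓ₀, hΓ₀'⟩ := hL.exists_isIntegralCurve hM (γ₀ 0)
  obtain ⟨Γ, hΓ, hΓ'⟩ := hL.exists_isIntegralCurve hM (γ 0)
  have hI : ∀ s ∈ Icc (-T) T, |s| ≤ T := fun s hs => abs_le.2 hs
  have e₀ : EqOn Γ₀ γ₀ (Icc (-T) T) := by
    rcases eq_or_lt_of_le hT with rfl | hT
    · intro s hs
      have : s = 0 := by simpa using hs
      rw [this, hΓ₀]
    refine ODE_solution_unique_of_mem_Icc (v := fun _ => g) (s := fun _ => univ) (K := L)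
      (fun s _ => hL.lipschitzOnWith) (t₀ := 0) ⟨by linarith, hT⟩ hΓ₀'.continuous.continuousOn
      (fun s _ => hΓ₀' s) (fun _ _ => trivial) h₀.continuous.continuousOn
      (fun s hs => ?_) (fun _ _ => trivial) hΓ₀
    rw [hgf (hmem s (Ioo_subset_Icc_self hs))]
    exact h₀ s
  have hdist : ∀ s ∈ Icc (-T) T, dist (Γ s) (γ₀ s) ≤ dist (γ 0) (γ₀ 0) * Real.exp (L * T) := by
    intro s hs
    have := hL.dist_integralCurve_le hΓ' hΓ₀' s
    rw [e₀ hs, hΓ, hΓ₀] at this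
    refine this.trans ?_
    gcongr
    exact hI s hs
  have hΓK : ∀ s ∈ Icc (-T) T, Γ s ∈ Metric.cthickening δ (γ₀ '' Icc (-T) T) := fun s hs =>
    Metric.mem_cthickening_of_dist_le _ _ _ _ (mem_image_of_mem _ hs)
      ((hdist s hs).trans hd.le)
  have e : EqOn Γ γ (Icc (-T) T) := by
    refine IsIntegralCurveOn.eqOn_of_contDiffOn hE hf ordConnected_Icc (fun s hs => ?_)
      (hγ.isIntegralCurveOn _) (fun s hs => hδE (hΓK s hs)) (fun s _ => hγE s) h0 hΓ
    have : HasDerivWithinAt Γ (g (Γ s)) (Icc (-T) T) s := (hΓ' s).hasDerivWithinAt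
    rwa [hgf (hΓK s hs)] at this
  rw [← e ht, mul_comm]
  exact hdist t ht

/-- If every point of `X` has a global solution staying in `X`, these solutions form a flow. -/
theorem exists_flow_of_isIntegralCurve [FiniteDimensional ℝ F] {f : F → F} {E X : Set F}
    (hE : IsOpen E) (hf : ContDiffOn ℝ 1 f E) (hXE : X ⊆ E)
    (hX : ∀ x ∈ X, ∃ γ : ℝ → F, γ 0 = x ∧ IsIntegralCurve γ (fun _ => f) ∧ ∀ t, γ t ∈ X) :
    ∃ φ : Flow ℝ X, ∀ x : X, IsIntegralCurve (fun t => (φ t x : F)) (fun _ => f) := by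
  choose Γ hΓ0 hΓ hΓX using fun x : X => hX x x.2
  have hΓE : ∀ x t, Γ x t ∈ E := fun x t => hXE (hΓX x t)
  refine ⟨⟨fun t x => ⟨Γ x t, hΓX x t⟩, ?_, ?_, ?_⟩, fun x => hΓ x⟩
  · rw [continuous_iff_continuousAt]
    rintro ⟨t₀, x₀⟩
    rw [ContinuousAt, tendsto_subtype_rng]
    obtain ⟨δ, hδ, C, hC⟩ := exists_dist_integralCurve_le hE hf (hΓ x₀) (hΓE x₀) (|t₀| + 1)
    have h1 : Tendsto (fun p : ℝ × X => Γ x₀ p.1) (𝓝 (t₀, x₀)) (𝓝 (Γ x₀ t₀)) :=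
      ((hΓ x₀).continuous.comp continuous_fst).tendsto (t₀, x₀)
    have hdist : Tendsto (fun p : ℝ × X => dist p.2 x₀) (𝓝 (t₀, x₀)) (𝓝 0) :=
      (continuous_snd.dist continuous_const).tendsto' (t₀, x₀) 0 (by simp)
    have h2 : Tendsto (fun p : ℝ × X => dist (Γ p.2 p.1) (Γ x₀ p.1)) (𝓝 (t₀, x₀)) (𝓝 0) := by
      refine squeeze_zero' (g := fun p : ℝ × X => C * dist p.2 x₀)
        (Eventually.of_forall fun _ => dist_nonneg) ?_ (by simpa using hdist.const_mul C)
      have ht : ∀ᶠ p : ℝ × X in 𝓝 (t₀, x₀), |p.1| < |t₀| + 1 :=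
        (continuous_fst.abs.continuousAt (x := (t₀, x₀))).eventually_lt continuousAt_const
          (by simp)
      filter_upwards [ht, hdist.eventually_lt_const hδ] with p hp hp'
      have := hC (Γ p.2) (hΓ _) (hΓE _) (by rw [hΓ0, hΓ0]; exact hp') p.1
        (abs_le.1 hp.le)
      rwa [hΓ0, hΓ0] at this
    rw [tendsto_iff_dist_tendsto_zero] at h1 ⊢
    refine squeeze_zero (fun _ => dist_nonneg) (fun p => dist_triangle _ (Γ x₀ p.1) _) ?_
    have h3 := h2.add h1
    rw [add_zero] at h3
    exact h3
  · intro t s x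
    apply Subtype.ext
    have : (fun r => Γ x (r + s)) = Γ ⟨Γ x s, hΓX x s⟩ :=
      IsIntegralCurve.eq_of_contDiffOn hE hf ((hΓ x).comp_add s) (hΓ _) (fun r => hΓE _ _)
        (hΓE _) (t₀ := 0) (by simp [hΓ0])
    exact congrFun this t
  · intro x
    exact Subtype.ext (hΓ0 x)

/-- Solutions in `X` on an interval are exactly the orbit segments of the flow. -/
theorem Flow.isIntegralCurveOn_iff {f : F → F} {E X : Set F}
    (hE : IsOpen E) (hf : ContDiffOn ℝ 1 f E) (hXE : X ⊆ E) (φ : Flow ℝ X)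
    (hφ : ∀ x : X, IsIntegralCurve (fun t => (φ t x : F)) (fun _ => f))
    {J : Set ℝ} (hJ : J.OrdConnected) (x : ℝ → X) :
    IsIntegralCurveOn (fun t => (x t : F)) (fun _ => f) J ↔
      ∀ s ∈ J, ∀ t ∈ J, x t = φ (t - s) (x s) := by
  constructor
  · intro h s hs t ht
    exact Subtype.ext (IsIntegralCurveOn.eqOn_of_contDiffOn hE hf hJ h
      (((hφ (x s)).comp_sub s).isIntegralCurveOn J) (fun r _ => hXE (x r).2)
      (fun r _ => hXE (φ (r - s) (x s)).2) hs (by simp) ht)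
  · intro h t ht
    have := (((hφ (x t)).comp_sub t) t).hasDerivWithinAt (s := J)
    simp only [Function.comp_def, sub_self, Flow.map_zero_apply] at this
    exact this.congr (fun s hs => by rw [h t ht s hs]) (by simp)

end ODE

/-! ### Lyapunov's theorem, from the spectral radius formula for 1 + εA. -/

section Lyapunov

/-- An element of a complex Banach algebra with spectrum in the open unit disc has geometrically
decaying powers. -/
theorem spectrum.exists_norm_pow_le_of_forall_norm_lt_one {R : Type*} [NormedRing R]
    [NormedAlgebra ℂ R] [CompleteSpace R] [Nontrivial R] {a : R}
    (h : ∀ z ∈ spectrum ℂ a, ‖z‖ < 1) :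
    ∃ r : ℝ, 0 ≤ r ∧ r < 1 ∧ ∀ᶠ k : ℕ in atTop, ‖a ^ k‖ ≤ r ^ k := by
  have hlt : spectralRadius ℂ a < ((1 : NNReal) : ENNReal) :=
    spectrum.spectralRadius_lt_of_forall_lt a fun z hz => by
      rw [← NNReal.coe_lt_coe]
      exact h z hz
  obtain ⟨r, hr, hr1⟩ := ENNReal.lt_iff_exists_nnreal_btwn.1 hlt
  refine ⟨r, r.2, by exact_mod_cast hr1, ?_⟩
  filter_upwards [(spectrum.pow_nnnorm_pow_one_div_tendsto_nhds_spectralRadius a).eventually_lt_const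
    hr, eventually_gt_atTop 0] with k hk hk0
  have hk0' : (0 : ℝ) < k := by exact_mod_cast hk0
  have := ENNReal.rpow_le_rpow hk.le hk0'.le
  rw [← ENNReal.rpow_mul, one_div_mul_cancel hk0'.ne', ENNReal.rpow_one, ENNReal.rpow_natCast] at this
  exact_mod_cast this

/-- If the spectrum of `a` lies in the open left half plane, then `1 + ε a` has spectrum in the
open unit disc for some `ε > 0`. -/
theorem spectrum.exists_forall_norm_lt_one_of_re_neg {R : Type*} [NormedRing R]
    [NormedAlgebra ℂ R] [CompleteSpace R] [Nontrivial R] {a : R}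
    (h : ∀ z ∈ spectrum ℂ a, z.re < 0) :
    ∃ ε : ℝ, 0 < ε ∧ ∀ z ∈ spectrum ℂ (1 + (ε : ℂ) • a), ‖z‖ < 1 := by
  obtain ⟨w, hw, hmax⟩ := (spectrum.isCompact (𝕜 := ℂ) a).exists_isMaxOn (spectrum.nonempty a)
    Complex.continuous_re.continuousOn
  set m := -w.re with hm
  have hm0 : 0 < m := by linarith [h w hw]
  set q := ‖a‖ * ‖(1 : R)‖ with hq
  have hpos : 0 < q ^ 2 + 1 := by positivity
  -- For Re μ ≤ -m and |μ| ≤ q, |1 + εμ|² ≤ 1 - 2εm + ε²q², and this ε gives ε²q² ≤ εm.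
  refine ⟨m / (q ^ 2 + 1), by positivity, fun z hz => ?_⟩
  set ε := m / (q ^ 2 + 1) with hε
  have hε0 : 0 < ε := by positivity
  have hεq : ε * (q ^ 2 + 1) = m := div_mul_cancel₀ _ hpos.ne'
  have e : 1 + (ε : ℂ) • a = Polynomial.aeval a (1 + Polynomial.C (ε : ℂ) * Polynomial.X) := by
    simp [Algebra.smul_def]
  rw [e, spectrum.map_polynomial_aeval] at hz
  obtain ⟨μ, hμ, rfl⟩ := hz
  have h1 : μ.re ≤ -m := by have := hmax hμ; simpa [hm] using this
  have h2 : ‖μ‖ ≤ q := spectrum.norm_le_norm_mul_of_mem hμ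
  have h3 : μ.re ^ 2 + μ.im ^ 2 ≤ q ^ 2 := by
    have := pow_le_pow_left₀ (norm_nonneg _) h2 2
    rwa [Complex.sq_norm, Complex.normSq_apply, ← sq, ← sq] at this
  have h4 : ‖1 + (ε : ℂ) * μ‖ ^ 2 < 1 := by
    rw [Complex.sq_norm, Complex.normSq_apply]
    simp only [Complex.add_re, Complex.one_re, Complex.mul_re, Complex.ofReal_re,
      Complex.ofReal_im, Complex.add_im, Complex.one_im, Complex.mul_im]
    have h5 : ε ^ 2 * (μ.re ^ 2 + μ.im ^ 2) ≤ ε ^ 2 * q ^ 2 := by gcongr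
    have h6 : ε ^ 2 * q ^ 2 ≤ ε * m := by rw [← hεq]; nlinarith [sq_nonneg ε]
    have h7 : ε * μ.re ≤ ε * -m := by gcongr
    have h8 : 0 < ε * m := by positivity
    nlinarith
  have h9 : ‖1 + (ε : ℂ) * μ‖ < 1 := by
    by_contra! hge
    nlinarith
  simpa using h9

/-- The complex matrix of a real operator. -/
noncomputable def complexMatrix (n : ℕ) :
    Module.End ℝ (EuclideanSpace ℝ (Fin n)) →ₐ[ℝ] Matrix (Fin n) (Fin n) ℂ :=
  (AlgHom.mapMatrix Complex.ofRealAm).comp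
    (LinearMap.toMatrixAlgEquiv (EuclideanSpace.basisFun (Fin n) ℝ).toBasis).toAlgHom

/-- Moves the eigenvalue hypothesis into a complex Banach algebra, where the spectral radius formula
applies. -/
theorem mem_spectrum_complexMatrix {n : ℕ}
    {A : EuclideanSpace ℝ (Fin n) →L[ℝ] EuclideanSpace ℝ (Fin n)} {μ : ℂ} :
    μ ∈ spectrum ℂ (complexMatrix n A) ↔ IsComplexEigenvalue A μ := by
  rw [IsComplexEigenvalue, Module.End.hasEigenvalue_iff_mem_spectrum,
    ← AlgEquiv.spectrum_eq (LinearMap.toMatrixAlgEquiv (Algebra.TensorProduct.basis ℂ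
      (EuclideanSpace.basisFun (Fin n) ℝ).toBasis))]
  have := LinearMap.toMatrix_baseChange ℂ
    (A : EuclideanSpace ℝ (Fin n) →ₗ[ℝ] EuclideanSpace ℝ (Fin n))
    (EuclideanSpace.basisFun (Fin n) ℝ).toBasis (EuclideanSpace.basisFun (Fin n) ℝ).toBasis
  rw [show complexMatrix n A = _ from this.symm]
  rfl

theorem LinearMap.exists_norm_le_mul {M N : Type*} [NormedAddCommGroup M] [NormedSpace ℝ M]
    [FiniteDimensional ℝ M] [NormedAddCommGroup N] [NormedSpace ℝ N] (ρ : M →ₗ[ℝ] N) :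
    ∃ K : ℝ, 0 ≤ K ∧ ∀ x, ‖ρ x‖ ≤ K * ‖x‖ :=
  ⟨‖LinearMap.toContinuousLinearMap ρ‖, norm_nonneg _,
    (LinearMap.toContinuousLinearMap ρ).le_opNorm⟩

attribute [local instance] Matrix.linftyOpNormedRing Matrix.linftyOpNormedAlgebra in
/-- The norm of a real operator is controlled by the norm of its complex matrix. -/
theorem exists_norm_le_complexMatrix (n : ℕ) :
    ∃ K : ℝ, 0 ≤ K ∧ ∀ T : EuclideanSpace ℝ (Fin n) →L[ℝ] EuclideanSpace ℝ (Fin n),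
      ‖T‖ ≤ K * ‖complexMatrix n T‖ := by
  set b := (EuclideanSpace.basisFun (Fin n) ℝ).toBasis
  -- Taking real parts of the entries is a linear left inverse of `complexMatrix`, bounded by finite
  -- dimensionality.
  let ρ : Matrix (Fin n) (Fin n) ℂ →ₗ[ℝ]
      (EuclideanSpace ℝ (Fin n) →L[ℝ] EuclideanSpace ℝ (Fin n)) :=
    (LinearMap.toContinuousLinearMap (𝕜 := ℝ)).toLinearMap ∘ₗ
      (LinearMap.toMatrixAlgEquiv b).symm.toLinearEquiv.toLinearMap ∘ₗ
      (LinearMap.mapMatrix Complex.reLm)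
  have hρ : ∀ T : EuclideanSpace ℝ (Fin n) →L[ℝ] EuclideanSpace ℝ (Fin n),
      ρ (complexMatrix n T) = T := by
    intro T
    have : (complexMatrix n T).map Complex.reLm = LinearMap.toMatrixAlgEquiv b
        (T : EuclideanSpace ℝ (Fin n) →ₗ[ℝ] EuclideanSpace ℝ (Fin n)) := by
      ext i j
      simp [complexMatrix, b]
    simp only [ρ, LinearMap.comp_apply, LinearMap.mapMatrix_apply, this]
    ext x
    simp
  obtain ⟨K, hK, h⟩ := ρ.exists_norm_le_mul
  exact ⟨K, hK, fun T => by simpa only [hρ] using h (complexMatrix n T)⟩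

-- The Euler step 1 + εA has spectrum in the open unit disc, so its powers decay geometrically. This
-- replaces the decay of e^{tA} and makes the Lyapunov operator a series instead of an integral.
attribute [local instance] Matrix.linftyOpNormedRing Matrix.linftyOpNormedAlgebra in
theorem exists_summable_norm_one_add_smul_pow {n : ℕ}
    (A : EuclideanSpace ℝ (Fin n) →L[ℝ] EuclideanSpace ℝ (Fin n))
    (h : ∀ μ : ℂ, IsComplexEigenvalue A μ → μ.re < 0) :
    ∃ ε : ℝ, 0 < ε ∧ Summable fun k : ℕ => ‖(1 + ε • A) ^ k‖ ^ 2 := by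
  rcases isEmpty_or_nonempty (Fin n) with hn | hn
  -- In dimension 0 the matrix algebra is trivial and the spectral lemmas do not apply.
  · refine ⟨1, one_pos, ?_⟩
    have : ∀ T : EuclideanSpace ℝ (Fin n) →L[ℝ] EuclideanSpace ℝ (Fin n), T = 0 :=
      fun T => Subsingleton.elim _ _
    simp [this _, summable_zero]
  obtain ⟨ε, hε, hlt⟩ := spectrum.exists_forall_norm_lt_one_of_re_neg (a := complexMatrix n A)
    fun z hz => h z (mem_spectrum_complexMatrix.1 hz)
  obtain ⟨r, hr0, hr1, hr⟩ := spectrum.exists_norm_pow_le_of_forall_norm_lt_one hlt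
  obtain ⟨K, hK, hKn⟩ := exists_norm_le_complexMatrix n
  refine ⟨ε, hε, Summable.of_norm_bounded_eventually_nat (g := fun k => K ^ 2 * (r ^ 2) ^ k)
    ((summable_geometric_of_lt_one (by positivity) (by nlinarith)).mul_left _) ?_⟩
  filter_upwards [hr] with k hk
  have e : complexMatrix n ((1 + ε • A) ^ k :
      EuclideanSpace ℝ (Fin n) →L[ℝ] EuclideanSpace ℝ (Fin n)) =
      (1 + (ε : ℂ) • complexMatrix n A) ^ k := by
    have : (((1 + ε • A) ^ k : EuclideanSpace ℝ (Fin n) →L[ℝ] EuclideanSpace ℝ (Fin n)) :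
        Module.End ℝ (EuclideanSpace ℝ (Fin n))) =
        (1 + ε • (A : Module.End ℝ (EuclideanSpace ℝ (Fin n)))) ^ k := by
      rw [ContinuousLinearMap.toLinearMap_pow]
      rfl
    rw [this, map_pow, map_add, map_one, map_smul]
    rfl
  have h1 := hKn ((1 + ε • A) ^ k)
  rw [e] at h1
  have h2 : ‖(1 + ε • A) ^ k‖ ≤ K * r ^ k := h1.trans (by gcongr)
  rw [Real.norm_of_nonneg (by positivity)]
  calc ‖(1 + ε • A) ^ k‖ ^ 2 ≤ (K * r ^ k) ^ 2 := by gcongr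
    _ = K ^ 2 * (r ^ 2) ^ k := by ring

/-- **Lyapunov's theorem**: an operator whose eigenvalues have negative real parts is strictly
dissipative with respect to some inner product `⟪P x, y⟫`. -/
theorem exists_lyapunov_operator {n : ℕ}
    (A : EuclideanSpace ℝ (Fin n) →L[ℝ] EuclideanSpace ℝ (Fin n))
    (h : ∀ μ : ℂ, IsComplexEigenvalue A μ → μ.re < 0) :
    ∃ P : EuclideanSpace ℝ (Fin n) →L[ℝ] EuclideanSpace ℝ (Fin n),
      (∀ x y, inner ℝ (P x) y = inner ℝ (P y) x) ∧ (∀ x, ‖x‖ ^ 2 ≤ inner ℝ (P x) x) ∧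
      ∃ c > 0, ∀ x, inner ℝ (P x) (A x) ≤ -c * ‖x‖ ^ 2 := by
  obtain ⟨ε, hε, hsum⟩ := exists_summable_norm_one_add_smul_pow A h
  set C := 1 + ε • A with hC
  have hS : Summable fun k : ℕ => ContinuousLinearMap.adjoint (C ^ k) ∘L (C ^ k) := by
    refine Summable.of_norm_bounded hsum fun k => ?_
    refine (ContinuousLinearMap.opNorm_comp_le _ _).trans ?_
    rw [LinearIsometryEquiv.norm_map, sq]
  set P := ∑' k : ℕ, ContinuousLinearMap.adjoint (C ^ k) ∘L (C ^ k) with hP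
  have hB : ∀ x y, HasSum (fun k : ℕ => inner ℝ ((C ^ k) x) ((C ^ k) y)) (inner ℝ (P x) y) := by
    intro x y
    have h1 := (ContinuousLinearMap.apply ℝ (EuclideanSpace ℝ (Fin n)) x).hasSum hS.hasSum
    have h2 := (innerSL ℝ y).hasSum h1
    rw [← hP] at h2
    simp only [innerSL_apply_apply, ContinuousLinearMap.apply_apply] at h2
    rw [real_inner_comm] at h2
    refine h2.congr_fun fun k => ?_
    simp [ContinuousLinearMap.adjoint_inner_right, real_inner_comm]
  have hsymm : ∀ x y, inner ℝ (P x) y = inner ℝ (P y) x := fun x y =>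
    (hB x y).unique (by simpa only [real_inner_comm] using hB y x)
  have hnn : ∀ x, 0 ≤ inner ℝ (P x) x := fun x => (hB x x).nonneg fun k => real_inner_self_nonneg
  -- The discrete Lyapunov equation P = 1 + C*PC: dropping the term k = 0 shifts the series.
  -- Expanding it with C = 1 + εA gives 2ε⟪P x, A x⟫ = -‖x‖² - ε²⟪P A x, A x⟫, whence the constant
  -- 1/(2ε).
  have hshift : ∀ x, inner ℝ (P x) x = ‖x‖ ^ 2 + inner ℝ (P (C x)) (C x) := by
    intro x
    refine (hB x x).unique ?_
    have := (hB (C x) (C x)).zero_add (f := fun k : ℕ => inner ℝ ((C ^ k) x) ((C ^ k) x))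
    simpa using this
  refine ⟨P, hsymm, fun x => by rw [hshift]; linarith [hnn (C x)], 1 / (2 * ε), by positivity,
    fun x => ?_⟩
  have h1 := hshift x
  have h2 : C x = x + ε • A x := by simp [hC]
  rw [h2, map_add, map_smul, inner_add_left, inner_add_right, inner_add_right, inner_smul_left,
    inner_smul_right, inner_smul_right, inner_smul_left, hsymm (A x) x] at h1
  have h3 := hnn (A x)
  have h4 : 0 ≤ ε * (ε * inner ℝ (P (A x)) (A x)) := by positivity
  simp only [conj_trivial] at h1
  have h5 : 2 * ε * inner ℝ (P x) (A x) ≤ -‖x‖ ^ 2 := by linarith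
  rw [neg_mul, one_div_mul_eq_div, ← neg_div, le_div_iff₀ (by positivity)]
  linarith

end Lyapunov

/-! ### Conjugating two flows through a level set that each nontrivial orbit crosses once. -/

section Conjugacy

/-- `p` is an attracting fixed point of the flow `φ`, and every other orbit crosses the level set
`{W = 1}` from `{W > 1}` into the trapping region `{W < 1}`. -/
structure IsTrappingLevel {X : Type*} [TopologicalSpace X] (φ : Flow ℝ X) (p : X) (W : X → ℝ) :
    Prop where
  continuous : Continuous W
  fixed : ∀ t, φ t p = p
  lt_one : W p < 1
  trap : ∀ x, W x ≤ 1 → ∀ t, 0 < t → W (φ t x) < 1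
  enter : ∀ x, ∃ t, W (φ t x) ≤ 1
  leave : ∀ x, x ≠ p → ∃ t, 1 ≤ W (φ t x)
  attract : ∀ N ∈ 𝓝 p, ∃ T, ∀ t, T ≤ t → ∀ x, W x = 1 → φ t x ∈ N

namespace IsTrappingLevel

variable {X : Type*} [TopologicalSpace X] {φ : Flow ℝ X} {p : X} {W : X → ℝ}

theorem ne_of_eq_one (h : IsTrappingLevel φ p W) {x : X} (hx : W x = 1) (t : ℝ) : φ t x ≠ p := by
  intro h'
  have : x = p := by
    rw [← h.fixed (-t), ← h', ← φ.map_add, neg_add_cancel, φ.map_zero_apply]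
  rw [this] at hx
  exact h.lt_one.ne hx

theorem exists_crossing (h : IsTrappingLevel φ p W) {x : X} (hx : x ≠ p) :
    ∃ t, W (φ t x) = 1 := by
  obtain ⟨a, ha⟩ := h.enter x
  obtain ⟨b, hb⟩ := h.leave x hx
  have hc : Continuous fun t => W (φ t x) :=
    h.continuous.comp (φ.continuous continuous_id continuous_const)
  exact mem_range_of_exists_le_of_exists_ge hc ⟨a, ha⟩ ⟨b, hb⟩

/-- The time at which the orbit of `x` crosses the level set `{W = 1}`. -/
noncomputable def crossingTime (φ : Flow ℝ X) (W : X → ℝ) (x : X) : ℝ :=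
  Classical.epsilon fun t => W (φ t x) = 1

theorem apply_crossingTime (h : IsTrappingLevel φ p W) {x : X} (hx : x ≠ p) :
    W (φ (crossingTime φ W x) x) = 1 :=
  Classical.epsilon_spec (h.exists_crossing hx)

theorem lt_one_of_lt (h : IsTrappingLevel φ p W) {x : X} {s t : ℝ} (hs : W (φ s x) ≤ 1)
    (hst : s < t) : W (φ t x) < 1 := by
  have := h.trap _ hs (t - s) (sub_pos.2 hst)
  rwa [← φ.map_add, sub_add_cancel] at this

theorem eq_crossingTime (h : IsTrappingLevel φ p W) {x : X} {t : ℝ} (ht : W (φ t x) = 1) :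
    crossingTime φ W x = t := by
  have h' : W (φ (crossingTime φ W x) x) = 1 :=
    Classical.epsilon_spec (p := fun t => W (φ t x) = 1) ⟨t, ht⟩
  rcases lt_trichotomy (crossingTime φ W x) t with hlt | heq | hlt
  · exact absurd ht (h.lt_one_of_lt h'.le hlt).ne
  · exact heq
  · exact absurd h' (h.lt_one_of_lt ht.le hlt).ne

theorem crossingTime_lt_iff (h : IsTrappingLevel φ p W) {x : X} (hx : x ≠ p) {a : ℝ} :
    crossingTime φ W x < a ↔ W (φ a x) < 1 := by
  refine ⟨h.lt_one_of_lt (h.apply_crossingTime hx).le, fun ha => ?_⟩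
  by_contra! hle
  have h1 := h.apply_crossingTime hx
  rcases hle.lt_or_eq with hlt | heq
  · exact (h.lt_one_of_lt ha.le hlt).ne h1
  · rw [← heq] at h1
    exact ha.ne h1

theorem lt_crossingTime_iff (h : IsTrappingLevel φ p W) {x : X} (hx : x ≠ p) {a : ℝ} :
    a < crossingTime φ W x ↔ 1 < W (φ a x) := by
  have h1 := h.apply_crossingTime hx
  rcases lt_trichotomy (crossingTime φ W x) a with hlt | heq | hlt
  · have := (h.crossingTime_lt_iff hx).1 hlt
    constructor <;> intro <;> linarith
  · rw [heq] at h1 ⊢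
    simp [h1]
  · refine iff_of_true hlt (lt_of_not_ge fun hle => ?_)
    exact (h.lt_one_of_lt hle hlt).ne h1

theorem crossingTime_apply (h : IsTrappingLevel φ p W) {x : X} (hx : x ≠ p) (t : ℝ) :
    crossingTime φ W (φ t x) = crossingTime φ W x - t := by
  apply h.eq_crossingTime
  rw [← φ.map_add, sub_add_cancel]
  exact h.apply_crossingTime hx

theorem continuous_flow_apply (h : IsTrappingLevel φ p W) (a : ℝ) :
    Continuous fun x => W (φ a x) := h.continuous.comp (φ.continuous_toFun a)

/-- Comparing the crossing time with a amounts to comparing W at time a with 1, which is an open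
condition on the initial point. -/
theorem continuousAt_crossingTime [T1Space X] (h : IsTrappingLevel φ p W) {x : X} (hx : x ≠ p) :
    ContinuousAt (crossingTime φ W) x := by
  have hne : ∀ᶠ y in 𝓝 x, y ≠ p := isOpen_ne.mem_nhds hx
  refine tendsto_order.2 ⟨fun a ha => ?_, fun a ha => ?_⟩
  · filter_upwards [hne, (h.continuous_flow_apply a).continuousAt.eventually_const_lt
      ((h.lt_crossingTime_iff hx).1 ha)] with y hy hy'
    exact (h.lt_crossingTime_iff hy).2 hy'
  · filter_upwards [hne, (h.continuous_flow_apply a).continuousAt.eventually_lt_const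
      ((h.crossingTime_lt_iff hx).1 ha)] with y hy hy'
    exact (h.crossingTime_lt_iff hy).2 hy'

theorem eventually_crossingTime_lt (h : IsTrappingLevel φ p W) (a : ℝ) :
    ∀ᶠ x in 𝓝 p, x ≠ p → crossingTime φ W x < a := by
  filter_upwards [(h.continuous_flow_apply a).continuousAt.eventually_lt_const
    (show W (φ a p) < 1 by rw [h.fixed]; exact h.lt_one)] with x hx hne
  exact (h.crossingTime_lt_iff hne).2 hx

variable {Y : Type*} [TopologicalSpace Y] {ψ : Flow ℝ Y} {q : Y} {U : Y → ℝ}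

open Classical in
/-- The conjugacy which maps the point reached from `s ∈ {W = 1}` at time `t` to the point reached
from `g s ∈ {U = 1}` at time `t`, and the fixed point to the fixed point. -/
noncomputable def conj (φ : Flow ℝ X) (p : X) (W : X → ℝ) (ψ : Flow ℝ Y) (q : Y) (U : Y → ℝ)
    (g : {x // W x = 1} → {y // U y = 1}) (x : X) : Y :=
  -- For a trapping level the second condition follows from the first; testing it lets the map be
  -- defined without that hypothesis.
  if hx : x ≠ p ∧ W (φ (crossingTime φ W x) x) = 1 then
    ψ (-crossingTime φ W x) (g ⟨_, hx.2⟩) else q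

variable {g : {x // W x = 1} → {y // U y = 1}}

theorem conj_fixed : conj φ p W ψ q U g p = q := by simp [conj]

theorem conj_of_ne (h : IsTrappingLevel φ p W) {x : X} (hx : x ≠ p) :
    conj φ p W ψ q U g x =
      ψ (-crossingTime φ W x) (g ⟨φ (crossingTime φ W x) x, h.apply_crossingTime hx⟩) := by
  simp [conj, hx, h.apply_crossingTime hx]

theorem conj_flow (h : IsTrappingLevel φ p W) (h' : IsTrappingLevel ψ q U) (t : ℝ) (x : X) :
    conj φ p W ψ q U g (φ t x) = ψ t (conj φ p W ψ q U g x) := by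
  by_cases hx : x = p
  · rw [hx, h.fixed, conj_fixed, h'.fixed]
  have hne : φ t x ≠ p := by
    intro h''
    apply hx
    rw [← h.fixed (-t), ← h'', ← φ.map_add, neg_add_cancel, φ.map_zero_apply]
  rw [h.conj_of_ne hx, h.conj_of_ne hne, ← ψ.map_add]
  have e : φ (crossingTime φ W (φ t x)) (φ t x) = φ (crossingTime φ W x) x := by
    rw [h.crossingTime_apply hx, ← φ.map_add, sub_add_cancel]
  simp only [e]
  congr 1
  rw [h.crossingTime_apply hx]
  ring

theorem conj_ne (h : IsTrappingLevel φ p W) (h' : IsTrappingLevel ψ q U) {x : X} (hx : x ≠ p) :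
    conj φ p W ψ q U g x ≠ q := by
  rw [h.conj_of_ne hx]
  exact h'.ne_of_eq_one (g _).2 _

/-- A point and its image have the same crossing time, so the same recipe with the inverse level map
undoes the first. -/
theorem conj_conj (h : IsTrappingLevel φ p W) (h' : IsTrappingLevel ψ q U)
    {k : {y // U y = 1} → {x // W x = 1}} (hk : Function.LeftInverse k g) (x : X) :
    conj ψ q U φ p W k (conj φ p W ψ q U g x) = x := by
  by_cases hx : x = p
  · rw [hx, conj_fixed, conj_fixed]
  have hy := h.conj_ne h' (g := g) hx
  have e : ψ (crossingTime φ W x) (conj φ p W ψ q U g x) =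
      g ⟨φ (crossingTime φ W x) x, h.apply_crossingTime hx⟩ := by
    rw [h.conj_of_ne hx, ← ψ.map_add, add_neg_cancel, ψ.map_zero_apply]
  have hτ : crossingTime ψ U (conj φ p W ψ q U g x) = crossingTime φ W x :=
    h'.eq_crossingTime (by rw [e]; exact (g _).2)
  rw [h'.conj_of_ne hy]
  simp only [hτ, e, Subtype.coe_eta, hk _]
  rw [← φ.map_add, neg_add_cancel, φ.map_zero_apply]

theorem continuous_conj [T1Space X] (h : IsTrappingLevel φ p W) (h' : IsTrappingLevel ψ q U)
    (hg : Continuous g) : Continuous (conj φ p W ψ q U g) := by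
  rw [continuous_iff_continuousAt]
  intro x
  by_cases hx : x = p
  · rw [hx, ContinuousAt, conj_fixed]
    intro N hN
    obtain ⟨T, hT⟩ := h'.attract N hN
    rw [mem_map]
    -- Near p the crossing lies more than T in the past, so the image has flowed for more than T
    -- from {U = 1} and is in N by uniform attraction.
    filter_upwards [h.eventually_crossingTime_lt (-T)] with y hy
    by_cases hyp : y = p
    · rw [mem_preimage, hyp, conj_fixed]
      exact mem_of_mem_nhds hN
    · rw [mem_preimage, h.conj_of_ne hyp]
      exact hT _ (by linarith [hy hyp]) _ (g _).2
  · have hopen : IsOpen {y | y ≠ p} := isOpen_ne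
    suffices ContinuousOn (conj φ p W ψ q U g) {y | y ≠ p} from
      this.continuousAt (hopen.mem_nhds hx)
    rw [continuousOn_iff_continuous_domRestrict]
    have hτ : Continuous fun y : {y | y ≠ p} => crossingTime φ W y :=
      continuous_iff_continuousAt.2 fun y =>
        (h.continuousAt_crossingTime y.2).comp continuousAt_subtype_val
    have e : domRestrict {y | y ≠ p} (conj φ p W ψ q U g) = fun y : {y | y ≠ p} =>
        ψ (-crossingTime φ W y) (g ⟨φ (crossingTime φ W y) y, h.apply_crossingTime y.2⟩) :=
      funext fun y => h.conj_of_ne y.2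
    rw [e]
    exact ψ.continuous hτ.neg (continuous_subtype_val.comp
      (hg.comp ((φ.continuous hτ continuous_subtype_val).subtype_mk _)))

/-- Two flows with trapping levels are conjugate as soon as the levels are homeomorphic. -/
theorem exists_homeomorph [T1Space X] [T1Space Y] (h : IsTrappingLevel φ p W)
    (h' : IsTrappingLevel ψ q U) (g : {x // W x = 1} ≃ₜ {y // U y = 1}) :
    ∃ H : X ≃ₜ Y, H p = q ∧ ∀ t x, H (φ t x) = ψ t (H x) :=
  ⟨{ toFun := conj φ p W ψ q U g
     invFun := conj ψ q U φ p W g.symm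
     left_inv := h.conj_conj h' g.left_inv
     right_inv := h'.conj_conj h g.right_inv
     continuous_toFun := h.continuous_conj h' g.continuous
     continuous_invFun := h'.continuous_conj h g.symm.continuous }, conj_fixed, h.conj_flow h'⟩

end IsTrappingLevel

end Conjugacy

/-! ### Quadratic Lyapunov functions and the trapping levels they give. -/

section QuadraticLyapunov

variable {F : Type*} [NormedAddCommGroup F] [InnerProductSpace ℝ F]

/-- On the sublevel set `{⟪P x, x⟫ ≤ a}`, contained in `E`, the quadratic form `⟪P x, x⟫` decays
exponentially along the solutions of `ẋ = f x`. -/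
structure IsQuadraticLyapunov (P : F →L[ℝ] F) (f : F → F) (E : Set F) (a k : ℝ) : Prop where
  symm : ∀ x y, inner ℝ (P x) y = inner ℝ (P y) x
  sq_norm_le : ∀ x, ‖x‖ ^ 2 ≤ inner ℝ (P x) x
  level_pos : 0 < a
  rate_pos : 0 < k
  mem : ∀ x, inner ℝ (P x) x ≤ a → x ∈ E
  inner_le : ∀ x, inner ℝ (P x) x ≤ a → inner ℝ (P x) (f x) ≤ -k * inner ℝ (P x) x

namespace IsQuadraticLyapunov

variable {P : F →L[ℝ] F} {f : F → F} {E : Set F} {a k : ℝ}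

theorem tendsto_mul_exp (h : IsQuadraticLyapunov P f E a k) :
    Tendsto (fun t => a * Real.exp (-k * t)) atTop (𝓝 0) := by
  have := (Real.tendsto_exp_neg_atTop_nhds_zero.comp
    (tendsto_id.const_mul_atTop h.rate_pos)).const_mul a
  simpa [Function.comp_def] using this

theorem decay (h : IsQuadraticLyapunov P f E a k) {γ : ℝ → F}
    (hγ : IsIntegralCurveOn γ (fun _ => f) (Ici 0)) {b : ℝ} (hb : 0 < b) (hba : b ≤ a)
    (h0 : inner ℝ (P (γ 0)) (γ 0) ≤ b) {t : ℝ} (ht : 0 ≤ t) :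
    inner ℝ (P (γ t)) (γ t) ≤ b * Real.exp (-k * t) := by
  have hk := h.rate_pos
  have hd : ∀ s ∈ Ici (0 : ℝ), HasDerivWithinAt (fun s => inner ℝ (P (γ s)) (γ s))
      (2 * inner ℝ (P (γ s)) (f (γ s))) (Ici 0) s := by
    intro s hs
    have h1 := (P.hasFDerivAt.comp_hasDerivWithinAt s (hγ s hs)).inner ℝ (hγ s hs)
    refine h1.congr_deriv ?_
    rw [h.symm (f (γ s)) (γ s)]
    simp only [Function.comp_apply]
    ring
  -- The derivatives are compared only where the form equals the barrier. There its value is at most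
  -- a, and its derivative is at most -2k times the value, strictly below the barrier's -k; this gap
  -- is why the rate is k and not 2k.
  refine image_le_of_deriv_right_lt_deriv_boundary (f := fun s => inner ℝ (P (γ s)) (γ s))
    (B := fun s => b * Real.exp (-k * s)) (B' := fun s => b * (Real.exp (-k * s) * -k))
    (a := 0) (b := t)
    (fun s hs => ((hd s hs.1).mono Icc_subset_Ici_self).continuousWithinAt)
    (fun s hs => (hd s hs.1).mono (Ici_subset_Ici.2 hs.1)) (by simpa using h0)
    (fun s => ?_) (fun s hs he => ?_) ⟨ht, le_rfl⟩
  · have := ((hasDerivAt_id s).const_mul (-k)).exp.const_mul b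
    simpa using this
  · have hpos : 0 < b * Real.exp (-k * s) := by positivity
    have hle : Real.exp (-k * s) ≤ 1 := Real.exp_le_one_iff.2 (by nlinarith [hs.1])
    have := h.inner_le (γ s) (by rw [he]; nlinarith)
    rw [he] at this
    nlinarith

theorem tendsto_zero (h : IsQuadraticLyapunov P f E a k) {γ : ℝ → F}
    (hγ : IsIntegralCurveOn γ (fun _ => f) (Ici 0))
    (h0 : inner ℝ (P (γ 0)) (γ 0) ≤ a) : Tendsto γ atTop (𝓝 0) := by
  have h2 : Tendsto (fun t => ‖γ t‖ ^ 2) atTop (𝓝 0) := by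
    refine squeeze_zero' (Eventually.of_forall fun t => sq_nonneg _) ?_ h.tendsto_mul_exp
    filter_upwards [eventually_ge_atTop 0] with t ht
    exact (h.sq_norm_le _).trans (h.decay hγ h.level_pos le_rfl h0 ht)
  rw [tendsto_zero_iff_norm_tendsto_zero]
  simpa using h2.sqrt

/-- Solutions starting in the sublevel set exist and stay there for all positive times. -/
theorem exists_isIntegralCurveOn [FiniteDimensional ℝ F] (h : IsQuadraticLyapunov P f E a k)
    (hE : IsOpen E) (hf : ContDiffOn ℝ 1 f E) {x : F} (hx : inner ℝ (P x) x ≤ a) :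
    ∃ γ : ℝ → F, γ 0 = x ∧ IsIntegralCurveOn γ (fun _ => f) (Ici 0) ∧
      ∀ t ∈ Ici (0 : ℝ), γ t ∈ E := by
  have := FiniteDimensional.proper_real F
  have hK : IsCompact {x : F | inner ℝ (P x) x ≤ a} := by
    refine Metric.isCompact_of_isClosed_isBounded
      (isClosed_le (P.continuous.inner continuous_id) continuous_const) ?_
    refine (Metric.isBounded_closedBall (x := (0 : F)) (r := √a)).subset fun y hy => ?_
    rw [mem_closedBall_zero_iff]
    exact Real.le_sqrt_of_sq_le ((h.sq_norm_le y).trans hy)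
  obtain ⟨g, L, M, hL, hM, hgf⟩ := hf.exists_lipschitzWith_bounded_eqOn hE hK h.mem
  -- The sublevel set is forward invariant for the complete field g, and g = f there, so the
  -- g-solution solves the original system.
  have hg : IsQuadraticLyapunov P g E a k :=
    { h with inner_le := fun y hy => by rw [hgf hy]; exact h.inner_le y hy }
  obtain ⟨γ, hγ0, hγ⟩ := hL.exists_isIntegralCurve hM x
  have hγD : ∀ t ∈ Ici (0 : ℝ), inner ℝ (P (γ t)) (γ t) ≤ a := by
    intro t ht
    have := hg.decay (hγ.isIntegralCurveOn _) h.level_pos le_rfl (by rwa [hγ0]) ht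
    have hle : Real.exp (-k * t) ≤ 1 :=
      Real.exp_le_one_iff.2 (by nlinarith [mem_Ici.1 ht, h.rate_pos])
    nlinarith [h.level_pos]
  refine ⟨γ, hγ0, fun t ht => ?_, fun t ht => h.mem _ (hγD t ht)⟩
  have : HasDerivWithinAt γ (g (γ t)) (Ici 0) t := (hγ t).hasDerivWithinAt
  rwa [hgf (hγD t ht)] at this

theorem isTrappingLevel [FiniteDimensional ℝ F] (h : IsQuadraticLyapunov P f E a k)
    (hE : IsOpen E) (hf : ContDiffOn ℝ 1 f E) (hf0 : f 0 = 0) {X : Set F} (hXE : X ⊆ E)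
    (h0X : (0 : F) ∈ X) (φ : Flow ℝ X)
    (hφ : ∀ x : X, IsIntegralCurve (fun t => (φ t x : F)) (fun _ => f))
    (hlim : ∀ x : X, Tendsto (fun t => (φ t x : F)) atTop (𝓝 0)) :
    IsTrappingLevel φ ⟨0, h0X⟩ (fun x => inner ℝ (P (x : F)) (x : F) / a) := by
  have ha := h.level_pos
  have hk := h.rate_pos
  have hdecay : ∀ x : X, inner ℝ (P (x : F)) (x : F) ≤ a → ∀ t, 0 ≤ t →
      inner ℝ (P (φ t x : F)) (φ t x : F) ≤ a * Real.exp (-k * t) := fun x hx t ht =>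
    h.decay ((hφ x).isIntegralCurveOn _) ha le_rfl (by simpa using hx) ht
  have hV : Continuous fun x : F => inner ℝ (P x) x := P.continuous.inner continuous_id
  have hexp : Tendsto (fun t => a * Real.exp (-k * t)) atTop (𝓝 0) := h.tendsto_mul_exp
  refine ⟨?_, fun t => ?_, by simp, fun x hx t ht => ?_, fun x => ?_, fun x hx => ?_,
    fun N hN => ?_⟩
  · exact (hV.comp continuous_subtype_val).div_const a
  · have h1 : IsIntegralCurve (fun _ : ℝ => (0 : F)) (fun _ => f) := fun s => by
      simpa [hf0] using hasDerivAt_const s (0 : F)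
    have := IsIntegralCurve.eq_of_contDiffOn hE hf (hφ ⟨0, h0X⟩) h1
      (fun t => hXE (φ t _).2) (fun _ => hXE h0X) (t₀ := 0) (by simp)
    exact Subtype.ext (congrFun this t)
  · rw [div_le_one ha] at hx
    rw [div_lt_one ha]
    have hlt : Real.exp (-k * t) < 1 := Real.exp_lt_one_iff.2 (by nlinarith)
    nlinarith [hdecay x hx t ht.le]
  · have h1 : Tendsto (fun t => inner ℝ (P (φ t x : F)) (φ t x : F)) atTop (𝓝 0) := by
      simpa [Function.comp_def] using (hV.tendsto 0).comp (hlim x)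
    obtain ⟨t, ht⟩ := (h1.eventually_lt_const ha).exists
    exact ⟨t, (div_le_one ha).2 ht.le⟩
  -- An orbit inside the level for all past times has V(x) ≤ a e^{-kt} for every t ≥ 0, by decay
  -- from time -t, which forces x = 0.
  · by_contra! hlt
    apply hx
    have h1 : ∀ t : ℝ, 0 ≤ t → inner ℝ (P (x : F)) (x : F) ≤ a * Real.exp (-k * t) := by
      intro t ht
      have := hdecay (φ (-t) x) ((div_lt_one ha).1 (hlt (-t))).le t ht
      rwa [← φ.map_add, add_neg_cancel, φ.map_zero_apply] at this
    have h2 : inner ℝ (P (x : F)) (x : F) ≤ 0 :=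
      ge_of_tendsto hexp ((eventually_ge_atTop 0).mono h1)
    have h3 := (h.sq_norm_le (x : F)).trans h2
    exact Subtype.ext (norm_eq_zero.1 (pow_eq_zero_iff two_ne_zero |>.1
      (le_antisymm h3 (sq_nonneg _))))
  · rw [nhds_subtype, mem_comap] at hN
    obtain ⟨U, hU, hUN⟩ := hN
    obtain ⟨r, hr, hrU⟩ := Metric.mem_nhds_iff.1 hU
    obtain ⟨T, hT⟩ := eventually_atTop.1 (hexp.eventually_lt_const (sq_pos_of_pos hr))
    refine ⟨max T 0, fun t ht x hx => hUN (hrU ?_)⟩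
    have hx' : inner ℝ (P (x : F)) (x : F) = a := (div_eq_one_iff_eq ha.ne').1 hx
    have h1 := hdecay x hx'.le t ((le_max_right _ _).trans ht)
    have h2 := hT t ((le_max_left _ _).trans ht)
    rw [mem_ball_zero_iff]
    exact lt_of_pow_lt_pow_left₀ 2 hr.le (((h.sq_norm_le _).trans h1).trans_lt h2)

end IsQuadraticLyapunov

/-- A quadratic Lyapunov function of the linearization is one for the system near the origin, and
one for the linearization on every sublevel set. -/
theorem exists_isQuadraticLyapunov {P A : F →L[ℝ] F} {f : F → F} {E : Set F} (hE : E ∈ 𝓝 0)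
    (hf : HasFDerivAt f A 0) (hf0 : f 0 = 0)
    (hsymm : ∀ x y, inner ℝ (P x) y = inner ℝ (P y) x)
    (hle : ∀ x, ‖x‖ ^ 2 ≤ inner ℝ (P x) x) {c : ℝ} (hc : 0 < c)
    (hA : ∀ x, inner ℝ (P x) (A x) ≤ -c * ‖x‖ ^ 2) :
    ∃ a k : ℝ, IsQuadraticLyapunov P f E a k ∧
      ∀ b, 0 < b → IsQuadraticLyapunov P A univ b k := by
  have hP : ∀ x, inner ℝ (P x) x ≤ (‖P‖ + 1) * ‖x‖ ^ 2 := fun x => by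
    have h1 := real_inner_le_norm (P x) x
    have h2 := mul_le_mul_of_nonneg_right (P.le_opNorm x) (norm_nonneg x)
    nlinarith [sq_nonneg ‖x‖]
  set q := ‖P‖ + 1 with hq
  have hq0 : 0 < q := by positivity
  -- Half of the dissipation c = 2kq absorbs the remainder, since ‖f x - A x‖ ≤ k‖x‖ contributes at
  -- most kq‖x‖²; the other half gives -kq‖x‖² ≤ -k⟪P x, x⟫.
  set k := c / (2 * q) with hk
  have hk0 : 0 < k := by positivity
  have hkq : 2 * (k * q) = c := by rw [hk]; field_simp
  have hsmall := (hasFDerivAt_iff_isLittleO.1 hf).def hk0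
  simp only [hf0, sub_zero] at hsmall
  obtain ⟨ρ, hρ, hball⟩ := Metric.eventually_nhds_iff_ball.1 (hsmall.and hE)
  refine ⟨ρ ^ 2 / 2, k, ⟨hsymm, hle, by positivity, hk0, fun x hx => ?_, fun x hx => ?_⟩,
    fun b hb => ⟨hsymm, hle, hb, hk0, fun _ _ => trivial, fun x _ => ?_⟩⟩
  · refine (hball x ?_).2
    rw [mem_ball_zero_iff]
    exact lt_of_pow_lt_pow_left₀ 2 hρ.le (by nlinarith [hle x])
  · have hxρ : x ∈ Metric.ball 0 ρ := by
      rw [mem_ball_zero_iff]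
      exact lt_of_pow_lt_pow_left₀ 2 hρ.le (by nlinarith [hle x])
    have h1 := (hball x hxρ).1
    have h2 : inner ℝ (P x) (f x - A x) ≤ q * k * ‖x‖ ^ 2 := by
      calc inner ℝ (P x) (f x - A x) ≤ ‖P x‖ * ‖f x - A x‖ := real_inner_le_norm _ _
        _ ≤ (q * ‖x‖) * (k * ‖x‖) := by
          gcongr
          exact (P.le_opNorm x).trans (by gcongr; linarith)
        _ = _ := by ring
    rw [inner_sub_right] at h2
    have h3 := mul_le_mul_of_nonneg_left (hP x) hk0.le
    have h4 := hA x
    rw [← hkq] at h4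
    nlinarith
  · have h3 := mul_le_mul_of_nonneg_left (hP x) hk0.le
    have h4 := hA x
    rw [← hkq] at h4
    have h5 : 0 ≤ k * q * ‖x‖ ^ 2 := by positivity
    nlinarith

end QuadraticLyapunov

/-! ### The region of attraction, the conjugacy on it, and time reversal. -/

section HartmanGrobman

variable {n : ℕ} {f : EuclideanSpace ℝ (Fin n) → EuclideanSpace ℝ (Fin n)}
  {E : Set (EuclideanSpace ℝ (Fin n))}

theorem regionOfAttraction_subset : regionOfAttraction f E ⊆ E := by
  rintro x ⟨γ, rfl, -, hE, -⟩
  exact hE 0 self_mem_Ici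

/-- Solutions starting in the region of attraction tend to `0`. -/
theorem tendsto_zero_of_mem_regionOfAttraction (hE : IsOpen E) (hf : ContDiffOn ℝ 1 f E)
    {γ : ℝ → EuclideanSpace ℝ (Fin n)} (hγ : IsIntegralCurve γ (fun _ => f))
    (hγE : ∀ t, γ t ∈ E) (h0 : γ 0 ∈ regionOfAttraction f E) : Tendsto γ atTop (𝓝 0) := by
  obtain ⟨σ, hσ0, hσ, hσE, hlim⟩ := h0
  have := IsIntegralCurveOn.eqOn_of_contDiffOn hE hf ordConnected_Ici hσ
    (hγ.isIntegralCurveOn _) hσE (fun t _ => hγE t) self_mem_Ici hσ0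
  refine hlim.congr' ?_
  filter_upwards [eventually_ge_atTop 0] with t ht using this ht

/-- A time shift keeps the limit, so the region is invariant in both time directions and carries a
flow. -/
theorem mem_regionOfAttraction_of_tendsto {γ : ℝ → EuclideanSpace ℝ (Fin n)}
    (hγ : IsIntegralCurve γ (fun _ => f)) (hγE : ∀ t, γ t ∈ E) (hlim : Tendsto γ atTop (𝓝 0))
    (t : ℝ) : γ t ∈ regionOfAttraction f E :=
  ⟨fun s => γ (s + t), by simp, (hγ.comp_add t).isIntegralCurveOn _, fun s _ => hγE _,
    hlim.comp (tendsto_atTop_add_const_right _ t tendsto_id)⟩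

theorem isIntegralCurve_exp_smul_apply {F : Type*} [NormedAddCommGroup F] [NormedSpace ℝ F]
    [CompleteSpace F] (A : F →L[ℝ] F) (x : F) :
    IsIntegralCurve (fun t : ℝ => NormedSpace.exp (t • A) x) (fun _ y => A y) := by
  intro t
  have := (ContinuousLinearMap.apply ℝ F x).hasFDerivAt.comp_hasDerivAt t
    (hasDerivAt_exp_smul_const' A t)
  simpa [Function.comp_def] using this

/-- The system on the basin of an exponentially stable equilibrium is conjugate to its
linearization. -/
theorem exists_homeomorph_regionOfAttraction (hE : IsOpen E)
    (h0E : (0 : EuclideanSpace ℝ (Fin n)) ∈ E) (hf : ContDiffOn ℝ 1 f E) (hf0 : f 0 = 0)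
    (hA : ∀ μ : ℂ, IsComplexEigenvalue (fderiv ℝ f 0) μ → μ.re < 0)
    (hΩ : ∀ x ∈ regionOfAttraction f E, HasGlobalSolution f E x) :
    ∃ H : regionOfAttraction f E ≃ₜ EuclideanSpace ℝ (Fin n),
      (∃ h0 : (0 : EuclideanSpace ℝ (Fin n)) ∈ regionOfAttraction f E, H ⟨0, h0⟩ = 0) ∧
      TransformsToLinear f (fderiv ℝ f 0) H := by
  set A := fderiv ℝ f 0
  obtain ⟨P, hsymm, hle, c, hc, hPA⟩ := exists_lyapunov_operator A hA
  have hfd : HasFDerivAt f A 0 :=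
    ((hf.contDiffAt (hE.mem_nhds h0E)).differentiableAt one_ne_zero).hasFDerivAt
  obtain ⟨a, k, hLf, hLA⟩ :=
    exists_isQuadraticLyapunov (hE.mem_nhds h0E) hfd hf0 hsymm hle hc hPA
  have ha := hLf.level_pos
  have hDΩ : ∀ x, inner ℝ (P x) x ≤ a → x ∈ regionOfAttraction f E := fun x hx => by
    obtain ⟨γ, rfl, hγ, hγE⟩ := hLf.exists_isIntegralCurveOn hE hf hx
    exact ⟨γ, rfl, hγ, hγE, hLf.tendsto_zero hγ hx⟩
  have h0 : (0 : EuclideanSpace ℝ (Fin n)) ∈ regionOfAttraction f E := hDΩ 0 (by simpa using ha.le)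
  have hglob : ∀ x ∈ regionOfAttraction f E, ∃ γ : ℝ → EuclideanSpace ℝ (Fin n),
      γ 0 = x ∧ IsIntegralCurve γ (fun _ => f) ∧ ∀ t, γ t ∈ regionOfAttraction f E := by
    intro x hx
    obtain ⟨γ, rfl, hγ, hγE⟩ := hΩ x hx
    exact ⟨γ, rfl, hγ, mem_regionOfAttraction_of_tendsto hγ hγE
      (tendsto_zero_of_mem_regionOfAttraction hE hf hγ hγE hx)⟩
  obtain ⟨φ, hφ⟩ := exists_flow_of_isIntegralCurve hE hf regionOfAttraction_subset hglob
  have hTf := hLf.isTrappingLevel hE hf hf0 regionOfAttraction_subset h0 φ hφ fun x =>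
    tendsto_zero_of_mem_regionOfAttraction hE hf (hφ x)
      (fun t => regionOfAttraction_subset (φ t x).2) (φ 0 x).2
  have hAc : ContDiffOn ℝ 1 (fun y => A y) univ := A.contDiff.contDiffOn
  obtain ⟨ψ, hψ⟩ := exists_flow_of_isIntegralCurve isOpen_univ hAc Subset.rfl fun x _ =>
    ⟨_, by simp, isIntegralCurve_exp_smul_apply A x, fun _ => trivial⟩
  have hTA := (hLA a ha).isTrappingLevel isOpen_univ hAc (map_zero A) Subset.rfl (mem_univ 0) ψ hψ
    -- The form decays for the linear system at every level, so the level may be taken large enough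
    -- to contain the given initial point.
    fun x => (hLA (max (inner ℝ (P (ψ 0 x : EuclideanSpace ℝ (Fin n))) (ψ 0 x)) a)
      (lt_max_of_lt_right ha)).tendsto_zero ((hψ x).isIntegralCurveOn _) (le_max_left _ _)
  -- Both levels are the same ellipsoid, which lies in the region of attraction, so the identity
  -- matches them.
  let g : {x : regionOfAttraction f E //
      inner ℝ (P (x : EuclideanSpace ℝ (Fin n))) (x : EuclideanSpace ℝ (Fin n)) / a = 1} ≃ₜ
      {y : (univ : Set (EuclideanSpace ℝ (Fin n))) //
        inner ℝ (P (y : EuclideanSpace ℝ (Fin n))) (y : EuclideanSpace ℝ (Fin n)) / a = 1} :=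
    { toFun := fun x => ⟨⟨x.1.1, trivial⟩, x.2⟩
      invFun := fun y => ⟨⟨y.1.1, hDΩ _ ((div_eq_one_iff_eq ha.ne').1 y.2).le⟩, y.2⟩
      left_inv := fun _ => rfl
      right_inv := fun _ => rfl
      continuous_toFun := by fun_prop
      continuous_invFun := by fun_prop }
  obtain ⟨H, hH0, hH⟩ := hTf.exists_homeomorph hTA g
  refine ⟨H.trans (Homeomorph.Set.univ _), ⟨h0, ?_⟩, fun J hJ x => ?_⟩
  · simp [hH0]
  · rw [φ.isIntegralCurveOn_iff hE hf regionOfAttraction_subset hφ hJ x]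
    have := ψ.isIntegralCurveOn_iff isOpen_univ hAc Subset.rfl hψ hJ fun t => H (x t)
    refine Iff.trans ?_ this.symm
    simp only [← hH, H.injective.eq_iff]

theorem isIntegralCurveOn_comp_neg_iff {F : Type*} [NormedAddCommGroup F] [NormedSpace ℝ F]
    {f : F → F} {γ : ℝ → F} {J : Set ℝ} :
    IsIntegralCurveOn (fun t => γ (-t)) (fun _ x => -f x) (Neg.neg ⁻¹' J) ↔
      IsIntegralCurveOn γ (fun _ => f) J := by
  refine ⟨fun h => ?_, fun h => h.comp_neg⟩
  have := IsIntegralCurveOn.comp_neg h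
  simpa [← preimage_comp, Function.comp_def] using this

theorem regionOfRepulsion_eq :
    regionOfRepulsion f E = regionOfAttraction (fun x => -f x) E := by
  ext x
  constructor
  · rintro ⟨γ, rfl, hγ, hγE, hlim⟩
    exact ⟨fun t => γ (-t), by simp, by simpa using hγ.comp_neg,
      fun t ht => hγE _ (by simpa using ht), hlim.comp tendsto_neg_atTop_atBot⟩
  · rintro ⟨γ, rfl, hγ, hγE, hlim⟩
    exact ⟨fun t => γ (-t), by simp, by simpa using hγ.comp_neg,
      fun t ht => hγE _ (by simpa using ht), hlim.comp tendsto_neg_atBot_atTop⟩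

theorem HasGlobalSolution.neg {x : EuclideanSpace ℝ (Fin n)} (h : HasGlobalSolution f E x) :
    HasGlobalSolution (fun x => -f x) E x := by
  obtain ⟨γ, h0, hγ, hγE⟩ := h
  exact ⟨fun t => γ (-t), by simpa using h0, hγ.comp_neg, fun t => hγE _⟩

theorem IsComplexEigenvalue.of_neg
    {A : EuclideanSpace ℝ (Fin n) →L[ℝ] EuclideanSpace ℝ (Fin n)} {μ : ℂ}
    (h : IsComplexEigenvalue (-A) μ) : IsComplexEigenvalue A (-μ) := by
  rw [IsComplexEigenvalue, Module.End.hasEigenvalue_iff_mem_spectrum] at h ⊢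
  rw [ContinuousLinearMap.toLinearMap_neg, LinearMap.baseChange_neg, ← spectrum.neg_eq] at h
  exact h

theorem TransformsToLinear.of_neg
    {A : EuclideanSpace ℝ (Fin n) →L[ℝ] EuclideanSpace ℝ (Fin n)}
    {Ω : Set (EuclideanSpace ℝ (Fin n))} {H : Ω ≃ₜ EuclideanSpace ℝ (Fin n)}
    (h : TransformsToLinear (fun x => -f x) (-A) H) : TransformsToLinear f A H := by
  intro J hJ x
  have := h (Neg.neg ⁻¹' J)
    ⟨fun s hs t ht r hr => hJ.out ht hs ⟨neg_le_neg hr.2, neg_le_neg hr.1⟩⟩ fun t => x (-t)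
  rw [isIntegralCurveOn_comp_neg_iff (γ := fun t => (x t : EuclideanSpace ℝ (Fin n)))] at this
  rw [this]
  exact isIntegralCurveOn_comp_neg_iff (f := fun y => A y) (γ := fun t => H (x t))

end HartmanGrobman

theorem theorem2 (n : ℕ) (E : Set (EuclideanSpace ℝ (Fin n))) (hE : IsOpen E)
    (h0E : (0 : EuclideanSpace ℝ (Fin n)) ∈ E)
    (f : EuclideanSpace ℝ (Fin n) → EuclideanSpace ℝ (Fin n))
    (hf : ContDiffOn ℝ 1 f E) (hf0 : f 0 = 0) :
    ((∀ μ : ℂ, IsComplexEigenvalue (fderiv ℝ f 0) μ → μ.re < 0) →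
      (∀ x ∈ regionOfAttraction f E, HasGlobalSolution f E x) →
      ∃ H : regionOfAttraction f E ≃ₜ EuclideanSpace ℝ (Fin n),
        (∃ h0 : (0 : EuclideanSpace ℝ (Fin n)) ∈ regionOfAttraction f E, H ⟨0, h0⟩ = 0) ∧
        TransformsToLinear f (fderiv ℝ f 0) H) ∧
    ((∀ μ : ℂ, IsComplexEigenvalue (fderiv ℝ f 0) μ → 0 < μ.re) →
      (∀ x ∈ regionOfRepulsion f E, HasGlobalSolution f E x) →
      ∃ H : regionOfRepulsion f E ≃ₜ EuclideanSpace ℝ (Fin n),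
        (∃ h0 : (0 : EuclideanSpace ℝ (Fin n)) ∈ regionOfRepulsion f E, H ⟨0, h0⟩ = 0) ∧
        TransformsToLinear f (fderiv ℝ f 0) H) := by
  refine ⟨exists_homeomorph_regionOfAttraction hE h0E hf hf0, fun hA hΩ => ?_⟩
  have hd : fderiv ℝ (fun x => -f x) 0 = -fderiv ℝ f 0 := fderiv_fun_neg
  rw [regionOfRepulsion_eq] at hΩ ⊢
  obtain ⟨H, hH0, hH⟩ := exists_homeomorph_regionOfAttraction hE h0E hf.neg (by simp [hf0])
    (fun μ hμ => by
      rw [hd] at hμ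
      simpa using hA _ hμ.of_neg) fun x hx => (hΩ x hx).neg
  rw [hd] at hH
  exact ⟨H, hH0, hH.of_neg⟩
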